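/- For a finite simple graph $G$ on $n$ vertices and a real number $\alpha$, let $s_\alpha(G)$ be the sum of the $\alpha$-th powers of the non-zero eigenvalues (counted with multiplicity) of the Laplacian matrix $L = D - A$ of $G$, where $D$ is the diagonal matrix of vertex degrees and $A$ the adjacency matrix. Let $d_1 \ge d_2 \ge \dots \ge d_n$ be the degree sequence of $G$ (the list of its vertex degrees in non-increasing order), and let $S_n$ be the star on $n$ vertices, in which one vertex is joined to all the others and there are no further edges. Let $G$ be a connected graph with $n \ge 2$ vertices. If $\alpha > 1$, then $$s_\alpha(G) \ge (d_1+1)^\alpha + \sum_{i=2}^{n-1} d_i^\alpha + (d_n-1)^\alpha,$$ and equality holds if and only if $G$ is isomorphic to $S_n$. If $0 < \alpha < 1$, then $$s_\alpha(G) \le (d_1+1)^\alpha + \sum_{i=2}^{n-1} d_i^\alpha + (d_n-1)^\alpha,$$ and equality holds if and only if $G$ is isomorphic to $S_n$. -/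

import Mathlib

namespace SimpleGraph

variable {V : Type*} [Fintype V] (G : SimpleGraph V) [DecidableRel G.Adj]

/-- The degree sequence of a finite graph: the list of the degrees of all vertices
(with multiplicity) in non-increasing order. -/
def degreeSequence : List ℕ :=
  (Finset.univ.val.map fun v : V => G.degree v).sort (· ≥ ·)

/-- The `i`-th term `d_i` of the degree sequence, numbered from `1` to the number of vertices
(with the irrelevant value `0` when `i` exceeds the number of vertices). -/
def deg (i : ℕ) : ℕ :=
  G.degreeSequence.getD (i - 1) 0

/-- The Laplacian eigenvalues of `G`, with multiplicity, indexed by the vertex type. -/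
noncomputable def laplacianEigenvalues [DecidableEq V] : V → ℝ :=
  (G.isHermitian_lapMatrix ℝ).eigenvalues

open Classical in
/-- `s_α(G)`: the sum of the `α`-th powers of the non-zero Laplacian eigenvalues of `G`,
counted with multiplicity. -/
noncomputable def laplacianPowerSum [DecidableEq V] (α : ℝ) : ℝ :=
  ∑ v : V with G.laplacianEigenvalues v ≠ 0, G.laplacianEigenvalues v ^ α

/-- The quantity `(d_1 + 1)^α + ∑_{i=2}^{n-1} d_i^α + (d_n - 1)^α`, where `n` is the number of
vertices of `G` and `d_1 ≥ ⋯ ≥ d_n` is its degree sequence; all arithmetic is in `ℝ`. -/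
noncomputable def degreePowerBound (α : ℝ) : ℝ :=
  ((G.deg 1 : ℝ) + 1) ^ α
    + ∑ i ∈ Finset.Icc 2 (Fintype.card V - 1), (G.deg i : ℝ) ^ α
    + ((G.deg (Fintype.card V) : ℝ) - 1) ^ α

/-- `G` is a star: some vertex (the center) is adjacent to all others, and there are no other
edges. On a vertex set of size `n` this says that `G` is (isomorphic to) `S_n`. -/
def IsStar {V : Type*} (G : SimpleGraph V) : Prop :=
  ∃ r : V, G = starGraph r

end SimpleGraph

/-! ### Karamata's inequality for powers -/

section Majorization

open Finset

/-! The Laplacian spectrum majorizes the sequence d_1 + 1, d_2, …, d_{n-1}, d_n - 1. Both have the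
same sum, the trace, and for 0 < k < n the k largest eigenvalues sum to at least d_1 + ⋯ + d_k + 1.
This is Grone's inequality (`Connected.sum_degree_add_one_le`), obtained from Ky Fan's principle
with a suitable projection of rank k. Karamata's inequality for t^α, convex for α > 1 and concave
for 0 < α < 1, then gives both bounds.

By strictness, equality for any one exponent means that the two sequences agree term by term, a
condition free of α. It can therefore be tested at exponent 2, where the power sums are ∑ d_i² + ∑
d_i (the trace of L²) and ∑ d_i² + 2(d_1 - d_n + 1). So equality means ∑ d_i = 2(d_1 - d_n + 1),
which for connected graphs singles out the stars. -/

theorem sum_mul_sub_nonneg_of_sum_range_le {N : ℕ} {x y c : ℕ → ℝ}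
    (hc : ∀ i j, i ≤ j → j < N → c j ≤ c i)
    (hle : ∀ k ≤ N, ∑ i ∈ range k, y i ≤ ∑ i ∈ range k, x i)
    (heq : ∑ i ∈ range N, y i = ∑ i ∈ range N, x i) :
    0 ≤ ∑ i ∈ range N, c i * (x i - y i) := by
  -- Abel summation by induction: the partial sums of x - y are nonnegative, so replacing the weight
  -- c_k by the smaller c_{k+1} only lowers the left side.
  have key : ∀ k, k + 1 ≤ N →
      c k * ∑ i ∈ range (k + 1), (x i - y i) ≤ ∑ i ∈ range (k + 1), c i * (x i - y i) := by
    intro k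
    induction k with
    | zero => intro _; simp
    | succ k ih =>
      intro hk
      have h1 := ih (by omega)
      have h2 := hle (k + 1) (by omega)
      have h3 := hc k (k + 1) (by omega) (by omega)
      have h4 : 0 ≤ ∑ i ∈ range (k + 1), (x i - y i) := by
        rw [sum_sub_distrib]; linarith
      rw [sum_range_succ, sum_range_succ (fun i => c i * (x i - y i)), mul_add]
      nlinarith
  cases N with
  | zero => simp
  | succ N =>
    refine le_trans (le_of_eq ?_) (key N le_rfl)
    rw [sum_sub_distrib, heq, sub_self, mul_zero]

/-- Bernoulli's inequality at s = x / y - 1, scaled by y ^ p; at y = 0 the tangent is the zero line.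
-/
theorem Real.rpow_tangent_lt_rpow {p x y : ℝ} (hp : 1 < p) (hx : 0 ≤ x) (hy : 0 ≤ y)
    (hxy : x ≠ y) : y ^ p + p * y ^ (p - 1) * (x - y) < x ^ p := by
  rcases hy.eq_or_lt with rfl | hy
  · rw [Real.zero_rpow (by linarith), Real.zero_rpow (by linarith)]
    simpa using Real.rpow_pos_of_pos (lt_of_le_of_ne hx hxy.symm) p
  · have hs : -1 ≤ x / y - 1 := by linarith [div_nonneg hx hy.le]
    have hs' : x / y - 1 ≠ 0 := by
      rw [sub_ne_zero, Ne, div_eq_one_iff_eq hy.ne']; exact hxy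
    have h := one_add_mul_self_lt_rpow_one_add hs hs' hp
    rw [add_sub_cancel, Real.div_rpow hx hy.le, lt_div_iff₀ (Real.rpow_pos_of_pos hy p)] at h
    refine lt_of_eq_of_lt ?_ h
    rw [Real.rpow_sub_one hy.ne']
    field_simp

theorem Real.rpow_lt_rpow_tangent {p x y : ℝ} (hp : 0 < p) (hp1 : p < 1) (hx : 0 ≤ x) (hy : 0 < y)
    (hxy : x ≠ y) : x ^ p < y ^ p + p * y ^ (p - 1) * (x - y) := by
  have hs : -1 ≤ x / y - 1 := by linarith [div_nonneg hx hy.le]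
  have hs' : x / y - 1 ≠ 0 := by
    rw [sub_ne_zero, Ne, div_eq_one_iff_eq hy.ne']; exact hxy
  have h := rpow_one_add_lt_one_add_mul_self hs hs' hp hp1
  rw [add_sub_cancel, Real.div_rpow hx hy.le, div_lt_iff₀ (Real.rpow_pos_of_pos hy p)] at h
  refine lt_of_lt_of_eq h ?_
  rw [Real.rpow_sub_one hy.ne']
  field_simp

/-- A tangent-line form of Karamata's inequality: `y` is majorized by `x`, the function values
satisfy a strict tangent inequality at each `y i`, and the slopes `c` are non-increasing. -/
theorem sum_le_sum_and_eq_iff_of_tangent {N : ℕ} {x y c : ℕ → ℝ} {f : ℝ → ℝ}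
    (hc : ∀ i j, i ≤ j → j < N → c j ≤ c i)
    (hle : ∀ k ≤ N, ∑ i ∈ range k, y i ≤ ∑ i ∈ range k, x i)
    (heq : ∑ i ∈ range N, y i = ∑ i ∈ range N, x i)
    (hf : ∀ i < N, x i ≠ y i → f (y i) + c i * (x i - y i) < f (x i)) :
    ∑ i ∈ range N, f (y i) ≤ ∑ i ∈ range N, f (x i) ∧
    (∑ i ∈ range N, f (x i) = ∑ i ∈ range N, f (y i) ↔ ∀ i < N, x i = y i) := by
  have h0 := sum_mul_sub_nonneg_of_sum_range_le hc hle heq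
  have hf' : ∀ i ∈ range N, f (y i) + c i * (x i - y i) ≤ f (x i) := by
    intro i hi
    by_cases h : x i = y i
    · simp [h]
    · exact (hf i (mem_range.1 hi) h).le
  have h1 := sum_le_sum hf'
  rw [sum_add_distrib] at h1
  refine ⟨by linarith, fun h => ?_, fun h => sum_congr rfl fun i hi => by rw [h i (mem_range.1 hi)]⟩
  by_contra! hne
  obtain ⟨i, hi, hne⟩ := hne
  have h2 := sum_lt_sum hf' ⟨i, mem_range.2 hi, hf i hi hne⟩
  rw [sum_add_distrib] at h2
  linarith

theorem sum_rpow_le_sum_rpow_and_eq_iff {N : ℕ} {x y : ℕ → ℝ} {p : ℝ} (hp : 1 < p)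
    (hx : ∀ i < N, 0 ≤ x i) (hy : ∀ i < N, 0 ≤ y i)
    (hanti : ∀ i j, i ≤ j → j < N → y j ≤ y i)
    (hle : ∀ k ≤ N, ∑ i ∈ range k, y i ≤ ∑ i ∈ range k, x i)
    (heq : ∑ i ∈ range N, y i = ∑ i ∈ range N, x i) :
    ∑ i ∈ range N, y i ^ p ≤ ∑ i ∈ range N, x i ^ p ∧
    (∑ i ∈ range N, x i ^ p = ∑ i ∈ range N, y i ^ p ↔ ∀ i < N, x i = y i) := by
  refine sum_le_sum_and_eq_iff_of_tangent (f := fun t => t ^ p)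
    (c := fun i => p * y i ^ (p - 1)) ?_ hle heq ?_
  · intro i j hij hj
    exact mul_le_mul_of_nonneg_left
      (Real.rpow_le_rpow (hy j hj) (hanti i j hij hj) (by linarith)) (by linarith)
  · intro i hi h
    exact Real.rpow_tangent_lt_rpow hp (hx i hi) (hy i hi) h

theorem sum_rpow_le_sum_rpow_and_eq_iff_of_lt_one {N : ℕ} {x y : ℕ → ℝ} {p : ℝ} (hp : 0 < p)
    (hp1 : p < 1) (hx : ∀ i < N, 0 ≤ x i)
    (hy : ∀ i < N, 1 ≤ y i ∨ y i = 0 ∧ x i = 0)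
    (hanti : ∀ i j, i ≤ j → j < N → y j ≤ y i)
    (hle : ∀ k ≤ N, ∑ i ∈ range k, y i ≤ ∑ i ∈ range k, x i)
    (heq : ∑ i ∈ range N, y i = ∑ i ∈ range N, x i) :
    ∑ i ∈ range N, x i ^ p ≤ ∑ i ∈ range N, y i ^ p ∧
    (∑ i ∈ range N, x i ^ p = ∑ i ∈ range N, y i ^ p ↔ ∀ i < N, x i = y i) := by
  -- At y i = 0 the tangent is vertical and `rpow` returns the junk slope 0. Since x i = y i there,
  -- any slope serves; `max (y i) 1` keeps the slopes monotone.
  have h := sum_le_sum_and_eq_iff_of_tangent (f := fun t => -t ^ p)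
    (c := fun i => -(p * max (y i) 1 ^ (p - 1))) ?_ hle heq ?_
  · simpa only [sum_neg_distrib, neg_le_neg_iff, neg_inj] using h
  · intro i j hij hj
    refine neg_le_neg (mul_le_mul_of_nonneg_left ?_ hp.le)
    exact Real.rpow_le_rpow_of_nonpos (by positivity) (max_le_max_right 1 (hanti i j hij hj))
      (by linarith)
  · intro i hi h
    rcases hy i hi with h1 | ⟨h1, h2⟩
    · have := Real.rpow_lt_rpow_tangent hp hp1 (hx i hi) (by linarith) h
      simp only [max_eq_left h1]
      linarith
    · exact absurd (h2.trans h1.symm) h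

end Majorization

/-! ### Ky Fan's principle for real symmetric matrices -/

section SymmetricMatrix

open Finset Matrix

/-- Ky Fan's weight inequality: weights in `[0, 1]` of total mass `k` give a non-increasing
sequence at most the sum of its first `k` terms. -/
theorem sum_mul_le_sum_range_of_antitone {N k : ℕ} (hk : k ≤ N) {lam p : ℕ → ℝ}
    (hanti : ∀ i j, i ≤ j → j < N → lam j ≤ lam i)
    (hp0 : ∀ i < N, 0 ≤ p i) (hp1 : ∀ i < N, p i ≤ 1) (hsum : ∑ i ∈ range N, p i = k) :
    ∑ i ∈ range N, lam i * p i ≤ ∑ i ∈ range k, lam i := by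
  rcases Nat.eq_zero_or_pos k with rfl | hk0
  · have : ∀ i ∈ range N, p i = 0 :=
      (sum_eq_zero_iff_of_nonneg fun i hi => hp0 i (mem_range.1 hi)).1 (by simpa using hsum)
    rw [range_zero, sum_empty, sum_eq_zero fun i hi => by rw [this i hi, mul_zero]]
  have hN : ∀ g : ℕ → ℝ, ∑ i ∈ range k, g i = ∑ i ∈ range N, if i < k then g i else 0 := by
    intro g
    rw [← sum_filter]
    congr 1
    ext i
    simp only [mem_range, mem_filter]
    omega
  have h1 : ∑ i ∈ range N, ((if i < k then (1 : ℝ) else 0) - p i) = 0 := by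
    rw [sum_sub_distrib, ← hN fun _ => 1, hsum]; simp
  -- Both factors are nonnegative for i < k and nonpositive afterwards. The pivot `lam (k - 1)`
  -- drops out on summing, as both weights have mass k.
  have h2 : ∀ i ∈ range N, 0 ≤ (lam i - lam (k - 1)) * ((if i < k then (1 : ℝ) else 0) - p i) := by
    intro i hi
    rw [mem_range] at hi
    split_ifs with h
    · exact mul_nonneg (by linarith [hanti i (k - 1) (by omega) (by omega)])
        (by linarith [hp1 i hi])
    · exact mul_nonneg_of_nonpos_of_nonpos (by linarith [hanti (k - 1) i (by omega) hi])
        (by linarith [hp0 i hi])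
  have h3 := sum_nonneg h2
  simp only [sub_mul, sum_sub_distrib, ← mul_sum] at h3
  rw [hN]
  have h4 : ∀ i, lam i * ((if i < k then (1 : ℝ) else 0) - p i) =
      (if i < k then lam i else 0) - lam i * p i := by
    intro i; split_ifs <;> ring
  rw [sum_sub_distrib] at h1
  simp only [h4, sum_sub_distrib, h1, mul_zero] at h3
  linarith

variable {n : Type*} [Fintype n] [DecidableEq n] {A : Matrix n n ℝ}

theorem Matrix.IsHermitian.sum_eigenvalues_comp (hA : A.IsHermitian) (f : ℝ → ℝ) :
    ∑ i, f (hA.eigenvalues i) = ∑ j, f (hA.eigenvalues₀ j) :=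
  Equiv.sum_comp (Fintype.equivOfCardEq (Fintype.card_fin _)).symm fun j => f (hA.eigenvalues₀ j)

theorem Matrix.IsHermitian.sum_eigenvalues_sq (hA : A.IsHermitian) :
    ∑ i, hA.eigenvalues i ^ 2 = (A * A).trace := by
  conv_rhs => rw [hA.spectral_theorem, ← map_mul, Unitary.conjStarAlgAut_apply, trace_mul_cycle]
  simp [pow_two, trace]

/-- A real symmetric matrix has an orthonormal eigenbasis `x` ordered as `eigenvalues₀`; the
clauses are normalization, Parseval's identity and diagonalization of the quadratic form. -/
theorem Matrix.IsHermitian.exists_sorted_eigenbasis (hA : A.IsHermitian) :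
    ∃ x : Fin (Fintype.card n) → n → ℝ, (∀ i, ∑ v, x i v ^ 2 = 1) ∧
      (∀ w : n → ℝ, ∑ i, (x i ⬝ᵥ w) ^ 2 = w ⬝ᵥ w) ∧
      ∀ w : n → ℝ, ∑ i, hA.eigenvalues₀ i * (x i ⬝ᵥ w) ^ 2 = w ⬝ᵥ (A *ᵥ w) := by
  set e : Fin (Fintype.card n) ≃ n := Fintype.equivOfCardEq (Fintype.card_fin _)
  set U : Matrix n n ℝ := hA.eigenvectorUnitary.1
  have hU1 : Uᵀ * U = 1 := by
    simpa [star_eq_conjTranspose] using Unitary.coe_star_mul_self hA.eigenvectorUnitary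
  have hU2 : U * Uᵀ = 1 := mul_eq_one_comm.1 hU1
  have hA' : A = U * diagonal hA.eigenvalues * Uᵀ := by
    conv_lhs => rw [hA.spectral_theorem, Unitary.conjStarAlgAut_apply]
    simp [U, star_eq_conjTranspose]
  refine ⟨fun i => Uᵀ (e i), fun i => ?_, fun w => ?_, fun w => ?_⟩
  · have := congrFun (congrFun hU1 (e i)) (e i)
    simpa [mul_apply, pow_two] using this
  · rw [Equiv.sum_comp e fun j => (Uᵀ j ⬝ᵥ w) ^ 2]
    have : w ⬝ᵥ w = (Uᵀ *ᵥ w) ⬝ᵥ (Uᵀ *ᵥ w) := by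
      rw [dotProduct_mulVec, vecMul_transpose, mulVec_mulVec, hU2, one_mulVec]
    rw [this]
    simp [dotProduct, mulVec, pow_two]
  · have h0 : ∀ i, hA.eigenvalues₀ i = hA.eigenvalues (e i) := by
      intro i; simp [IsHermitian.eigenvalues, e]
    simp only [h0]
    rw [Equiv.sum_comp e fun j => hA.eigenvalues j * (Uᵀ j ⬝ᵥ w) ^ 2]
    have : w ⬝ᵥ (A *ᵥ w) = (Uᵀ *ᵥ w) ⬝ᵥ (diagonal hA.eigenvalues *ᵥ (Uᵀ *ᵥ w)) := by
      conv_lhs => rw [hA']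
      rw [← mulVec_mulVec, ← mulVec_mulVec, dotProduct_mulVec, ← mulVec_transpose]
    rw [this]
    simp only [dotProduct, mulVec_diagonal]
    simp only [mulVec, dotProduct]
    exact sum_congr rfl fun j _ => by ring

/-- The `k`-th largest eigenvalue (from `k = 0`), and `0` beyond the size of the matrix. -/
noncomputable def Matrix.IsHermitian.nthEigenvalue (hA : A.IsHermitian) (k : ℕ) : ℝ :=
  if h : k < Fintype.card n then hA.eigenvalues₀ ⟨k, h⟩ else 0

theorem Matrix.IsHermitian.nthEigenvalue_coe (hA : A.IsHermitian) (i : Fin (Fintype.card n)) :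
    hA.nthEigenvalue i = hA.eigenvalues₀ i := by
  simp [nthEigenvalue]

theorem Matrix.IsHermitian.nthEigenvalue_anti (hA : A.IsHermitian) {i j : ℕ} (hij : i ≤ j)
    (hj : j < Fintype.card n) : hA.nthEigenvalue j ≤ hA.nthEigenvalue i := by
  rw [nthEigenvalue, nthEigenvalue, dif_pos hj, dif_pos (hij.trans_lt hj)]
  exact hA.eigenvalues₀_antitone hij

theorem Matrix.IsHermitian.sum_range_nthEigenvalue (hA : A.IsHermitian) (f : ℝ → ℝ) :
    ∑ i ∈ range (Fintype.card n), f (hA.nthEigenvalue i) = ∑ i, f (hA.eigenvalues i) := by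
  rw [hA.sum_eigenvalues_comp, sum_range]
  simp [nthEigenvalue_coe]

theorem Matrix.IsHermitian.sum_eigenvalues₀_mul_le (hA : A.IsHermitian) {k : ℕ}
    (hk : k ≤ Fintype.card n) {p : Fin (Fintype.card n) → ℝ} (hp0 : ∀ i, 0 ≤ p i)
    (hp1 : ∀ i, p i ≤ 1) (hsum : ∑ i, p i = k) :
    ∑ i, hA.eigenvalues₀ i * p i ≤ ∑ i ∈ range k, hA.nthEigenvalue i := by
  have h := sum_mul_le_sum_range_of_antitone hk (lam := hA.nthEigenvalue)
    (p := fun i => if h : i < Fintype.card n then p ⟨i, h⟩ else 0)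
    (fun i j hij hj => hA.nthEigenvalue_anti hij hj)
    (fun i hi => by simp [hi, hp0]) (fun i hi => by simp [hi, hp1])
    (by rw [sum_range]; simpa using hsum)
  rw [sum_range] at h
  simpa [nthEigenvalue_coe] using h

end SymmetricMatrix

/-! ### Cauchy–Schwarz estimates -/

section SumOfSquares

open Finset

theorem sq_sum_div_card_le_sum_sq {ι : Type*} (T : Finset ι) (y : ι → ℝ) :
    (∑ v ∈ T, y v) ^ 2 / #T ≤ ∑ v ∈ T, y v ^ 2 := by
  rcases T.eq_empty_or_nonempty with rfl | hT
  · simp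
  · rw [div_le_iff₀ (by exact_mod_cast hT.card_pos), mul_comm]
    exact sq_sum_le_card_mul_sum_sq

theorem add_sq_div_add_le {a b s t : ℝ} (hs : 0 < s) (ht : 0 < t) :
    (a + b) ^ 2 / (s + t) ≤ a ^ 2 / s + b ^ 2 / t := by
  rw [div_add_div _ _ hs.ne' ht.ne', div_le_div_iff₀ (by positivity) (by positivity)]
  nlinarith [sq_nonneg (a * t - b * s)]

end SumOfSquares

namespace SimpleGraph

/-! ### Grone's inequality -/

section PartialSums

open Finset Matrix

variable {V : Type*} [Fintype V] [DecidableEq V] (G : SimpleGraph V) [DecidableRel G.Adj]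

theorem lapMatrix_apply_self (v : V) : G.lapMatrix ℝ v v = G.degree v := by
  simp [lapMatrix, degMatrix]

/-- The Laplacian quadratic form at an indicator vector counts the boundary edges. -/
theorem indicator_dotProduct_lapMatrix_mulVec (B : Finset V) :
    (fun v => if v ∈ B then (1 : ℝ) else 0) ⬝ᵥ
      (G.lapMatrix ℝ *ᵥ fun v => if v ∈ B then (1 : ℝ) else 0) =
    ∑ v ∈ B, ∑ u ∈ Bᶜ, if G.Adj v u then (1 : ℝ) else 0 := by
  simp only [dotProduct, lapMatrix_mulVec_apply, ite_mul, one_mul, zero_mul]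
  rw [sum_ite_mem, univ_inter]
  refine sum_congr rfl fun v hv => ?_
  have h1 : (∑ u ∈ G.neighborFinset v, if u ∈ B then (1 : ℝ) else 0) =
      ∑ u ∈ B, if G.Adj v u then (1 : ℝ) else 0 := by
    simp only [sum_boole]
    congr 2
    ext u
    simp [and_comm]
  rw [h1, if_pos hv, mul_one, degree_eq_sum_if_adj, ← sum_add_sum_compl B]
  ring

/-- Grone's inequality: in a connected graph, the largest Laplacian eigenvalues, as many as a
proper nonempty vertex set has elements, sum to more than its degree sum. -/
theorem Connected.sum_degree_add_one_le (hG : G.Connected) {S : Finset V} (hS : S.Nonempty)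
    (hS' : S ≠ univ) :
    ∑ v ∈ S, (G.degree v : ℝ) + 1 ≤
      ∑ i ∈ range #S, (G.isHermitian_lapMatrix ℝ).nthEigenvalue i := by
  obtain ⟨x, hx1, hx2, hx3⟩ := (G.isHermitian_lapMatrix ℝ).exists_sorted_eigenbasis
  set T : Finset V := {v | v ∉ S ∧ ∃ s ∈ S, G.Adj v s} with hT
  have hdisj : Disjoint S T := by
    rw [Finset.disjoint_left]; intro v hv hv'; simp [hT, hv] at hv'
  have hTne : T.Nonempty := by
    obtain ⟨a, ha⟩ := hS
    obtain ⟨b, hb⟩ : ∃ b, b ∉ S := by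
      by_contra! h; exact hS' (eq_univ_of_forall h)
    obtain ⟨w⟩ := hG.preconnected a b
    obtain ⟨d, -, h1, h2⟩ := w.exists_boundary_dart (S : Set V) ha hb
    exact ⟨d.snd, by simpa [hT] using ⟨by simpa using h2, d.fst, h1, d.adj.symm⟩⟩
  have hk : (0 : ℝ) < #S := by exact_mod_cast hS.card_pos
  have ht : (0 : ℝ) < #T := by exact_mod_cast hTne.card_pos
  -- With T the outer boundary of S, `p i` is the quadratic form at `x i` of the projection onto the
  -- orthogonal complement of 1_{S ∪ T} in the span of 1_T and the e_s, s ∈ S. It has rank #S.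
  set p : Fin (Fintype.card V) → ℝ := fun i => ∑ s ∈ S, x i s ^ 2 +
    (∑ v ∈ T, x i v) ^ 2 / #T - (∑ v ∈ S ∪ T, x i v) ^ 2 / (#S + #T) with hp
  have hp0 : ∀ i, 0 ≤ p i := by
    intro i
    have h1 := sq_sum_div_card_le_sum_sq S (x i)
    have h2 := add_sq_div_add_le (a := ∑ v ∈ S, x i v) (b := ∑ v ∈ T, x i v) hk ht
    simp only [hp]
    rw [sum_union hdisj]
    linarith
  have hp1 : ∀ i, p i ≤ 1 := by
    intro i
    have h1 := sq_sum_div_card_le_sum_sq T (x i)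
    have h2 : ∑ v ∈ S ∪ T, x i v ^ 2 ≤ ∑ v, x i v ^ 2 :=
      sum_le_sum_of_subset_of_nonneg (subset_univ _) fun _ _ _ => sq_nonneg _
    rw [sum_union hdisj, hx1] at h2
    have h3 : 0 ≤ (∑ v ∈ S ∪ T, x i v) ^ 2 / ((#S : ℝ) + #T) := by positivity
    simp only [hp]
    linarith
  have hind : ∀ (B : Finset V) i,
      x i ⬝ᵥ (fun v => if v ∈ B then (1 : ℝ) else 0) = ∑ v ∈ B, x i v := by
    intro B i; simp [dotProduct]
  have hindsq : ∀ B : Finset V, ∑ i, (∑ v ∈ B, x i v) ^ 2 = #B := by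
    intro B
    have := hx2 fun v => if v ∈ B then (1 : ℝ) else 0
    simp only [hind] at this
    rw [this]; simp [dotProduct]
  have hindq : ∀ B : Finset V,
      ∑ i, (G.isHermitian_lapMatrix ℝ).eigenvalues₀ i * (∑ v ∈ B, x i v) ^ 2 =
        ∑ v ∈ B, ∑ u ∈ Bᶜ, if G.Adj v u then (1 : ℝ) else 0 := by
    intro B
    rw [← indicator_dotProduct_lapMatrix_mulVec, ← hx3]
    simp only [hind]
  have hsq : ∀ s, ∑ i, x i s ^ 2 = 1 := by
    intro s
    simpa using hx2 (Pi.single s 1)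
  have hq : ∀ s, ∑ i, (G.isHermitian_lapMatrix ℝ).eigenvalues₀ i * x i s ^ 2 = G.degree s := by
    intro s
    simpa [lapMatrix_apply_self] using hx3 (Pi.single s 1)
  have hsum : ∑ i, p i = (#S : ℕ) := by
    simp only [hp, sum_sub_distrib, sum_add_distrib, ← sum_div]
    rw [sum_comm, hindsq, hindsq, card_union_of_disjoint hdisj]
    simp only [hsq, sum_const, nsmul_eq_mul, mul_one]
    push_cast
    rw [div_self ht.ne', div_self (by positivity)]
    ring
  have key := (G.isHermitian_lapMatrix ℝ).sum_eigenvalues₀_mul_le (card_le_univ S) hp0 hp1 hsum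
  refine le_trans ?_ key
  -- This is the trace of L times the projection. Of the edges leaving T, at least #T go to S and
  -- give the extra 1; the r others contribute r / #T - r / (#S + #T) ≥ 0.
  have hL : ∑ i, (G.isHermitian_lapMatrix ℝ).eigenvalues₀ i * p i = ∑ s ∈ S, (G.degree s : ℝ) +
      (∑ v ∈ T, ∑ u ∈ Tᶜ, if G.Adj v u then (1 : ℝ) else 0) / #T -
      (∑ v ∈ S ∪ T, ∑ u ∈ (S ∪ T)ᶜ, if G.Adj v u then (1 : ℝ) else 0) / (#S + #T) := by
    simp only [hp, mul_sub, mul_add, sum_sub_distrib, sum_add_distrib, mul_sum, ← mul_div_assoc,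
      ← sum_div, hindq]
    rw [sum_comm]
    simp only [hq]
  have hSR : ∑ v ∈ S, ∑ u ∈ (S ∪ T)ᶜ, (if G.Adj v u then (1 : ℝ) else 0) = 0 := by
    refine sum_eq_zero fun v hv => sum_eq_zero fun u hu => if_neg fun h => ?_
    simp only [hT, mem_compl, mem_union, mem_filter, mem_univ, true_and, not_or, not_and] at hu
    exact hu.2 hu.1 ⟨v, hv, h.symm⟩
  have hTS : (#T : ℝ) ≤ ∑ v ∈ T, ∑ u ∈ S, if G.Adj v u then (1 : ℝ) else 0 := by
    have : ∀ v ∈ T, (1 : ℝ) ≤ ∑ u ∈ S, if G.Adj v u then (1 : ℝ) else 0 := by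
      intro v hv
      obtain ⟨s, hs, hvs⟩ := (mem_filter.1 hv).2.2
      refine le_trans (by simp [hvs]) (single_le_sum (f := fun u => if G.Adj v u then (1 : ℝ) else 0)
        (fun u _ => by positivity) hs)
    simpa using sum_le_sum this
  have hTc : Tᶜ = S ∪ (S ∪ T)ᶜ := by
    ext v
    have : v ∈ S → v ∉ T := fun h => Finset.disjoint_left.1 hdisj h
    simp only [mem_compl, mem_union]
    tauto
  have hd : Disjoint S (S ∪ T)ᶜ := by
    rw [Finset.disjoint_left]; intro v hv; simp [hv]
  rw [hL, sum_union hdisj, hSR, zero_add, hTc]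
  simp only [sum_union hd, sum_add_distrib]
  set r := ∑ v ∈ T, ∑ u ∈ (S ∪ T)ᶜ, if G.Adj v u then (1 : ℝ) else 0
  have hr : 0 ≤ r := sum_nonneg fun v _ => sum_nonneg fun u _ => by positivity
  have h1 := div_le_div_of_nonneg_left hr ht (by linarith : (#T : ℝ) ≤ #S + #T)
  have h2 := (one_le_div ht).2 hTS
  rw [add_div]
  linarith

end PartialSums

end SimpleGraph

namespace SimpleGraph

/-! ### Degree sequences and the star criterion -/

section DegreeSequence

open Finset

variable {V : Type*} [Fintype V] (G : SimpleGraph V) [DecidableRel G.Adj]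

theorem exists_equiv_deg_eq_degree :
    ∃ σ : Fin (Fintype.card V) ≃ V, (∀ i : Fin (Fintype.card V), G.deg (i + 1) = G.degree (σ i)) ∧
      Antitone fun i => G.degree (σ i) := by
  set e := (Fintype.equivFin V).symm
  set f : Fin (Fintype.card V) → ℕᵒᵈ := fun i => OrderDual.toDual (G.degree (e i))
  set σ : Fin (Fintype.card V) ≃ V := (Tuple.sort f).trans e
  have hσ : Antitone fun i => G.degree (σ i) := fun i j hij => Tuple.monotone_sort f hij
  refine ⟨σ, fun i => ?_, hσ⟩
  have h : G.degreeSequence = List.ofFn fun i => G.degree (σ i) := by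
    refine List.Perm.eq_of_pairwise' (r := (· ≥ ·)) (Multiset.pairwise_sort _ _) ?_ ?_
    · exact List.pairwise_ofFn.2 fun i j hij => hσ hij.le
    · rw [← Multiset.coe_eq_coe, degreeSequence, Multiset.sort_eq, ← Fin.univ_val_map]
      rw [← Multiset.map_univ_val_equiv σ, Multiset.map_map]
      rfl
  rw [deg, h]
  simp

theorem deg_anti {i j : ℕ} (hij : i ≤ j) (hj : j < Fintype.card V) :
    G.deg (j + 1) ≤ G.deg (i + 1) := by
  obtain ⟨σ, h1, h2⟩ := G.exists_equiv_deg_eq_degree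
  have hi := h1 ⟨i, hij.trans_lt hj⟩
  have hj' := h1 ⟨j, hj⟩
  simp only at hi hj'
  rw [hi, hj']
  exact h2 hij

theorem sum_range_deg (f : ℝ → ℝ) :
    ∑ i ∈ range (Fintype.card V), f (G.deg (i + 1)) = ∑ v, f (G.degree v) := by
  obtain ⟨σ, h1, -⟩ := G.exists_equiv_deg_eq_degree
  rw [sum_range, ← Equiv.sum_comp σ]
  simp only [h1]

theorem exists_sum_range_deg_eq {k : ℕ} (hk : k ≤ Fintype.card V) :
    ∃ S : Finset V, #S = k ∧
      ∑ i ∈ range k, (G.deg (i + 1) : ℝ) = ∑ v ∈ S, (G.degree v : ℝ) := by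
  obtain ⟨σ, h1, -⟩ := G.exists_equiv_deg_eq_degree
  refine ⟨univ.map ((Fin.castLEEmb hk).trans σ.toEmbedding), by simp, ?_⟩
  rw [sum_map, sum_range]
  refine sum_congr rfl fun i _ => ?_
  have := h1 (Fin.castLE hk i)
  simp only [Fin.val_castLE] at this
  rw [this]
  rfl

theorem one_le_deg [Nontrivial V] (hG : G.Connected) {i : ℕ} (hi : i < Fintype.card V) :
    1 ≤ G.deg (i + 1) := by
  obtain ⟨σ, h1, -⟩ := G.exists_equiv_deg_eq_degree
  have := h1 ⟨i, hi⟩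
  simp only at this
  rw [this]
  exact hG.preconnected.degree_pos_of_nontrivial _

theorem degree_le_deg_one (v : V) : G.degree v ≤ G.deg 1 := by
  obtain ⟨σ, h1, h2⟩ := G.exists_equiv_deg_eq_degree
  have hpos : 0 < Fintype.card V := Fintype.card_pos_iff.2 ⟨v⟩
  have h := h1 ⟨0, hpos⟩
  simp only [zero_add] at h
  rw [h, ← σ.apply_symm_apply v]
  exact h2 (Fin.mk_le_of_le_val (Nat.zero_le _))

theorem deg_card_le_degree (v : V) : G.deg (Fintype.card V) ≤ G.degree v := by
  obtain ⟨σ, h1, h2⟩ := G.exists_equiv_deg_eq_degree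
  have hpos : 0 < Fintype.card V := Fintype.card_pos_iff.2 ⟨v⟩
  have h := h1 ⟨Fintype.card V - 1, by omega⟩
  simp only [Nat.sub_add_cancel hpos] at h
  rw [h, ← σ.apply_symm_apply v]
  exact h2 (Fin.le_def.2 (by simp; omega))

theorem exists_degree_eq_deg_one [Nonempty V] : ∃ v, G.degree v = G.deg 1 := by
  obtain ⟨σ, h1, -⟩ := G.exists_equiv_deg_eq_degree
  exact ⟨_, (h1 ⟨0, Fintype.card_pos⟩).symm⟩

theorem exists_degree_eq_deg_card [Nonempty V] : ∃ v, G.degree v = G.deg (Fintype.card V) := by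
  obtain ⟨σ, h1, -⟩ := G.exists_equiv_deg_eq_degree
  have hpos : 0 < Fintype.card V := Fintype.card_pos
  have h := h1 ⟨Fintype.card V - 1, by omega⟩
  simp only [Nat.sub_add_cancel hpos] at h
  exact ⟨_, h.symm⟩

/-- The sequence `d_1 + 1, d_2, …, d_{n-1}, d_n - 1`, numbered from `0`. -/
noncomputable def shiftedDeg (i : ℕ) : ℝ :=
  G.deg (i + 1) + (if i = 0 then 1 else 0) - (if i + 1 = Fintype.card V then 1 else 0)

theorem degreePowerBound_eq_sum_shiftedDeg (hcard : 2 ≤ Fintype.card V) (α : ℝ) :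
    G.degreePowerBound α = ∑ i ∈ range (Fintype.card V), G.shiftedDeg i ^ α := by
  obtain ⟨m, hm⟩ : ∃ m, Fintype.card V = m + 2 := ⟨_, (Nat.sub_add_cancel hcard).symm⟩
  have hI : ∑ i ∈ Icc 2 (m + 1), (G.deg i : ℝ) ^ α =
      ∑ i ∈ range m, (G.deg (i + 2) : ℝ) ^ α := by
    rw [range_eq_Ico, sum_Ico_add' (fun i => (G.deg i : ℝ) ^ α) 0 m 2]
    rfl
  rw [degreePowerBound, hm, sum_range_succ, sum_range_succ', show m + 2 - 1 = m + 1 from rfl, hI,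
    add_comm (((G.deg 1 : ℝ) + 1) ^ α)]
  congr 2
  · refine sum_congr rfl fun i hi => ?_
    have : i ≠ m := (mem_range.1 hi).ne
    simp [shiftedDeg, hm, this]
  · simp [shiftedDeg, hm]
  · simp [shiftedDeg, hm]

theorem shiftedDeg_anti {i j : ℕ} (hij : i ≤ j)
    (hj : j < Fintype.card V) : G.shiftedDeg j ≤ G.shiftedDeg i := by
  rcases hij.eq_or_lt with rfl | hlt
  · rfl
  have h : (G.deg (j + 1) : ℝ) ≤ G.deg (i + 1) := by exact_mod_cast G.deg_anti hij hj
  rw [shiftedDeg, shiftedDeg, if_neg (by omega : j ≠ 0),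
    if_neg (by omega : i + 1 ≠ Fintype.card V)]
  split_ifs <;> linarith

theorem sum_range_shiftedDeg {k : ℕ} (hk0 : 0 < k) (hk : k ≤ Fintype.card V) :
    ∑ i ∈ range k, G.shiftedDeg i =
      ∑ i ∈ range k, (G.deg (i + 1) : ℝ) + 1 - if k = Fintype.card V then 1 else 0 := by
  have h : ∀ i, i + 1 = Fintype.card V ↔ i = Fintype.card V - 1 := by intro i; omega
  simp only [shiftedDeg, sum_sub_distrib, sum_add_distrib, h, sum_ite_eq', mem_range, hk0, if_true]
  congr 2
  exact propext (by omega)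

theorem sum_shiftedDeg_sq (hcard : 2 ≤ Fintype.card V) :
    ∑ i ∈ range (Fintype.card V), G.shiftedDeg i ^ 2 =
      ∑ v, (G.degree v : ℝ) ^ 2 + 2 * (G.deg 1 - G.deg (Fintype.card V) + 1) := by
  have h : ∀ i, i + 1 = Fintype.card V ↔ i = Fintype.card V - 1 := by intro i; omega
  have h1 : ∀ i, G.shiftedDeg i ^ 2 = (G.deg (i + 1) : ℝ) ^ 2 +
      (if i = 0 then 2 * (G.deg 1 : ℝ) + 1 else 0) +
      (if i = Fintype.card V - 1 then 1 - 2 * (G.deg (Fintype.card V) : ℝ) else 0) := by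
    intro i
    simp only [shiftedDeg, ← h]
    split_ifs with h1 h2 h2
    · omega
    · subst h1; ring
    · rw [h2]; ring
    · ring
  simp only [h1, sum_add_distrib, sum_ite_eq', mem_range]
  rw [if_pos (by omega), if_pos (by omega), G.sum_range_deg fun t => t ^ 2]
  ring

/-- Only d_n - 1 can vanish, when there is a pendant vertex; this isolates the singular point of t^α
for α < 1. -/
theorem shiftedDeg_eq_zero_or_one_le (hG : G.Connected) (hcard : 2 ≤ Fintype.card V) {i : ℕ}
    (hi : i < Fintype.card V) :
    1 ≤ G.shiftedDeg i ∨ i + 1 = Fintype.card V ∧ G.shiftedDeg i = 0 := by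
  have : Nontrivial V := Fintype.one_lt_card_iff_nontrivial.1 hcard
  have h1 := G.one_le_deg hG hi
  by_cases hl : i + 1 = Fintype.card V
  · rw [shiftedDeg, if_neg (by omega : i ≠ 0), if_pos hl]
    rcases h1.eq_or_lt with h | h
    · exact Or.inr ⟨hl, by simp [← h]⟩
    · left
      have : (2 : ℝ) ≤ G.deg (i + 1) := by exact_mod_cast h
      linarith
  · left
    have : (1 : ℝ) ≤ G.deg (i + 1) := by exact_mod_cast h1
    rw [shiftedDeg, if_neg hl]
    split_ifs <;> linarith

/-- The degree-sum condition characterizing stars among connected graphs. -/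
theorem isStar_iff_sum_degree_eq (hG : G.Connected) (hcard : 2 ≤ Fintype.card V) :
    G.IsStar ↔ ∑ v, (G.degree v : ℝ) = 2 * (G.deg 1 - G.deg (Fintype.card V) + 1) := by
  classical
  have hnt : Nontrivial V := Fintype.one_lt_card_iff_nontrivial.1 hcard
  constructor
  · rintro ⟨r, hr⟩
    have hdr : G.degree r = Fintype.card V - 1 := by
      rw [← degree_starGraph_center (r := r)]; subst hr; congr!
    have hdv : ∀ v, v ≠ r → G.degree v = 1 := by
      intro v hv
      rw [← degree_starGraph_of_ne_center hv]; subst hr; congr!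
    obtain ⟨a, ha⟩ := G.exists_degree_eq_deg_one
    obtain ⟨b, hb⟩ := G.exists_degree_eq_deg_card
    obtain ⟨c, hc⟩ := exists_ne r
    have h1 : G.deg 1 = Fintype.card V - 1 := by
      refine le_antisymm ?_ (hdr ▸ G.degree_le_deg_one r)
      rw [← ha]; exact Nat.le_sub_one_of_lt (G.degree_lt_card_verts a)
    have h2 : G.deg (Fintype.card V) = 1 := by
      refine le_antisymm (hdv c hc ▸ G.deg_card_le_degree c) ?_
      rw [← hb]; exact hG.preconnected.degree_pos_of_nontrivial b
    rw [← add_sum_erase univ _ (mem_univ r), sum_congr rfl fun v hv => by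
      rw [hdv v (ne_of_mem_erase hv)], h1, h2, hdr, Nat.cast_sub (by omega)]
    rw [sum_const, card_erase_of_mem (mem_univ r), card_univ, nsmul_eq_mul,
      Nat.cast_sub (by omega)]
    push_cast
    ring
  · intro h
    obtain ⟨r, hr⟩ := G.exists_degree_eq_deg_one
    obtain ⟨b, hb⟩ := G.exists_degree_eq_deg_card
    have hpos : ∀ v, 1 ≤ G.degree v := fun v => hG.preconnected.degree_pos_of_nontrivial v
    have hlt := G.degree_lt_card_verts r
    have hn : ∑ v, G.degree v + 2 * G.deg (Fintype.card V) = 2 * (G.deg 1 + 1) := by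
      have : (∑ v, (G.degree v : ℝ)) + 2 * G.deg (Fintype.card V) = 2 * (G.deg 1 + 1) := by
        rw [h]; ring
      exact_mod_cast this
    rw [← add_sum_erase univ _ (mem_univ r), hr, ← hb] at hn
    have h1 : ∑ v ∈ univ.erase r, 1 ≤ ∑ v ∈ univ.erase r, G.degree v :=
      sum_le_sum fun v _ => hpos v
    have hc : ∑ v ∈ univ.erase r, 1 = Fintype.card V - 1 := by
      simp [card_erase_of_mem]
    have hb1 := hpos b
    -- The degrees off r sum to d_1 + 2 - 2 d_n ≤ d_1 ≤ n - 1, and to at least n - 1.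
    have heq : ∑ v ∈ univ.erase r, 1 = ∑ v ∈ univ.erase r, G.degree v := by omega
    have hall : ∀ v, v ≠ r → G.degree v = 1 := fun v hv =>
      ((sum_eq_sum_iff_of_le fun v _ => hpos v).1 heq v (by simp [hv])).symm
    have hdeg : G.degree r = Fintype.card V - 1 := by omega
    have huniv : G.neighborFinset r = univ.erase r := by
      refine eq_of_subset_of_card_le (fun v hv => ?_) ?_
      · rw [mem_neighborFinset] at hv
        simp [hv.ne']
      · rw [card_neighborFinset_eq_degree, hdeg, card_erase_of_mem (mem_univ r), card_univ]
    have hadj : ∀ v, v ≠ r → G.Adj r v := by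
      intro v hv
      rw [← mem_neighborFinset, huniv]; simp [hv]
    refine ⟨r, ?_⟩
    ext u v
    rw [starGraph_adj]
    constructor
    · intro huv
      refine ⟨huv.ne, or_iff_not_imp_left.2 fun hu => ?_⟩
      obtain ⟨w, -, hw⟩ := degree_eq_one_iff_existsUnique_adj.1 (hall u hu)
      rw [hw v huv, hw r (hadj u hu).symm]
    · rintro ⟨hne, rfl | rfl⟩
      · exact hadj v hne.symm
      · exact (hadj u hne).symm

end DegreeSequence

/-! ### Laplacian spectrum: moments and majorization -/

section Spectrum

open Finset Matrix

variable {V : Type*} [Fintype V] [DecidableEq V] (G : SimpleGraph V) [DecidableRel G.Adj]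

/-- The Laplacian eigenvalues in non-increasing order, numbered from `0`. -/
noncomputable def nthLaplacianEigenvalue (i : ℕ) : ℝ :=
  (G.isHermitian_lapMatrix ℝ).nthEigenvalue i

theorem sum_range_nthLaplacianEigenvalue (f : ℝ → ℝ) :
    ∑ i ∈ range (Fintype.card V), f (G.nthLaplacianEigenvalue i) =
      ∑ v, f (G.laplacianEigenvalues v) :=
  (G.isHermitian_lapMatrix ℝ).sum_range_nthEigenvalue f

theorem laplacianPowerSum_eq {α : ℝ} (hα : α ≠ 0) :
    G.laplacianPowerSum α =
      ∑ i ∈ range (Fintype.card V), G.nthLaplacianEigenvalue i ^ α := by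
  rw [G.sum_range_nthLaplacianEigenvalue fun t => t ^ α, laplacianPowerSum]
  refine sum_filter_of_ne fun v _ h h0 => h ?_
  rw [h0, Real.zero_rpow hα]

theorem nthLaplacianEigenvalue_nonneg {i : ℕ} (hi : i < Fintype.card V) :
    0 ≤ G.nthLaplacianEigenvalue i := by
  have h : 0 ≤ G.laplacianEigenvalues (Fintype.equivOfCardEq (Fintype.card_fin _) ⟨i, hi⟩) :=
    (G.posSemidef_lapMatrix (R := ℝ)).eigenvalues_nonneg _
  simpa [nthLaplacianEigenvalue, IsHermitian.nthEigenvalue, hi, laplacianEigenvalues,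
    IsHermitian.eigenvalues] using h

theorem sum_range_nthLaplacianEigenvalue_eq_sum_degree :
    ∑ i ∈ range (Fintype.card V), G.nthLaplacianEigenvalue i = ∑ v, (G.degree v : ℝ) := by
  rw [G.sum_range_nthLaplacianEigenvalue fun t => t]
  have h := (G.isHermitian_lapMatrix ℝ).trace_eq_sum_eigenvalues
  simp only [trace, diag_apply, lapMatrix_apply_self, RCLike.ofReal_real_eq_id, id] at h
  exact h.symm

theorem trace_lapMatrix_mul_self :
    (G.lapMatrix ℝ * G.lapMatrix ℝ).trace = ∑ v, (G.degree v : ℝ) ^ 2 + ∑ v, (G.degree v : ℝ) := by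
  rw [trace, ← sum_add_distrib]
  refine sum_congr rfl fun v _ => ?_
  have h : ∀ u, G.lapMatrix ℝ v u * G.lapMatrix ℝ u v =
      (if u = v then (G.degree v : ℝ) ^ 2 else 0) + if G.Adj v u then 1 else 0 := by
    intro u
    by_cases huv : u = v
    · subst huv; simp [lapMatrix_apply_self, pow_two]
    · by_cases h : G.Adj v u <;>
        simp [lapMatrix, degMatrix, huv, Ne.symm huv, G.adj_comm u v, h]
  rw [diag_apply, mul_apply, sum_congr rfl fun u _ => h u, sum_add_distrib,
    ← degree_eq_sum_if_adj]
  simp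

theorem sum_range_nthLaplacianEigenvalue_sq :
    ∑ i ∈ range (Fintype.card V), G.nthLaplacianEigenvalue i ^ 2 =
      ∑ v, (G.degree v : ℝ) ^ 2 + ∑ v, (G.degree v : ℝ) := by
  rw [G.sum_range_nthLaplacianEigenvalue fun t => t ^ 2, ← trace_lapMatrix_mul_self]
  exact (G.isHermitian_lapMatrix ℝ).sum_eigenvalues_sq

theorem sum_range_shiftedDeg_eq_sum_nthLaplacianEigenvalue (hcard : 2 ≤ Fintype.card V) :
    ∑ i ∈ range (Fintype.card V), G.shiftedDeg i =
      ∑ i ∈ range (Fintype.card V), G.nthLaplacianEigenvalue i := by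
  rw [G.sum_range_shiftedDeg (by omega) le_rfl, if_pos rfl, G.sum_range_deg fun t => t,
    sum_range_nthLaplacianEigenvalue_eq_sum_degree]
  ring

/-- The Laplacian spectrum of a connected graph majorizes `d_1 + 1, d_2, …, d_{n-1}, d_n - 1`. -/
theorem Connected.sum_range_shiftedDeg_le (hG : G.Connected) (hcard : 2 ≤ Fintype.card V) {k : ℕ}
    (hk : k ≤ Fintype.card V) :
    ∑ i ∈ range k, G.shiftedDeg i ≤ ∑ i ∈ range k, G.nthLaplacianEigenvalue i := by
  rcases hk.eq_or_lt with rfl | hlt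
  · exact (G.sum_range_shiftedDeg_eq_sum_nthLaplacianEigenvalue hcard).le
  rcases Nat.eq_zero_or_pos k with rfl | hk0
  · simp
  obtain ⟨S, rfl, hS⟩ := G.exists_sum_range_deg_eq hk
  rw [G.sum_range_shiftedDeg hk0 hk, if_neg hlt.ne, hS, sub_zero]
  refine hG.sum_degree_add_one_le G (card_pos.1 hk0) ?_
  rintro rfl
  exact hlt.ne card_univ

theorem Connected.nthLaplacianEigenvalue_last_le (hG : G.Connected) (hcard : 2 ≤ Fintype.card V)
    {i : ℕ} (hi : i + 1 = Fintype.card V) :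
    G.nthLaplacianEigenvalue i ≤ G.shiftedDeg i := by
  have h1 := G.sum_range_shiftedDeg_eq_sum_nthLaplacianEigenvalue hcard
  have h2 := hG.sum_range_shiftedDeg_le G hcard (k := i) (by omega)
  rw [← hi, sum_range_succ, sum_range_succ] at h1
  linarith

/-- The equality case of Karamata at exponent 2, where both power sums are explicit in the degrees.
-/
theorem Connected.nthLaplacianEigenvalue_eq_shiftedDeg_iff (hG : G.Connected)
    (hcard : 2 ≤ Fintype.card V) :
    (∀ i < Fintype.card V, G.nthLaplacianEigenvalue i = G.shiftedDeg i) ↔ G.IsStar := by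
  have hnn : ∀ i < Fintype.card V, 0 ≤ G.shiftedDeg i := fun i hi => by
    rcases G.shiftedDeg_eq_zero_or_one_le hG hcard hi with h | ⟨-, h⟩ <;> linarith
  have h := (sum_rpow_le_sum_rpow_and_eq_iff (p := 2) (by norm_num)
    (fun i hi => G.nthLaplacianEigenvalue_nonneg hi) hnn
    (fun i j hij hj => G.shiftedDeg_anti hij hj)
    (fun k hk => hG.sum_range_shiftedDeg_le G hcard hk)
    (G.sum_range_shiftedDeg_eq_sum_nthLaplacianEigenvalue hcard)).2
  simp only [Real.rpow_two] at h
  rw [← h, sum_range_nthLaplacianEigenvalue_sq, G.sum_shiftedDeg_sq hcard, add_right_inj,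
    G.isStar_iff_sum_degree_eq hG hcard]

end Spectrum

end SimpleGraph

/-! ### The main theorem -/

theorem proposition1 {V : Type*} [Fintype V] [DecidableEq V]
    (G : SimpleGraph V) [DecidableRel G.Adj]
    (hconn : G.Connected) (hcard : 2 ≤ Fintype.card V) (α : ℝ) :
    (1 < α →
      G.laplacianPowerSum α ≥ G.degreePowerBound α ∧
      (G.laplacianPowerSum α = G.degreePowerBound α ↔ G.IsStar)) ∧
    (0 < α → α < 1 →
      G.laplacianPowerSum α ≤ G.degreePowerBound α ∧
      (G.laplacianPowerSum α = G.degreePowerBound α ↔ G.IsStar)) := by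
  have hanti : ∀ i j, i ≤ j → j < Fintype.card V → G.shiftedDeg j ≤ G.shiftedDeg i :=
    fun i j hij hj => G.shiftedDeg_anti hij hj
  have hle : ∀ k ≤ Fintype.card V, ∑ i ∈ Finset.range k, G.shiftedDeg i ≤
      ∑ i ∈ Finset.range k, G.nthLaplacianEigenvalue i :=
    fun k hk => hconn.sum_range_shiftedDeg_le G hcard hk
  have heq := G.sum_range_shiftedDeg_eq_sum_nthLaplacianEigenvalue hcard
  have hx : ∀ i < Fintype.card V, 0 ≤ G.nthLaplacianEigenvalue i :=
    fun i hi => G.nthLaplacianEigenvalue_nonneg hi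
  have hy : ∀ i < Fintype.card V,
      1 ≤ G.shiftedDeg i ∨ G.shiftedDeg i = 0 ∧ G.nthLaplacianEigenvalue i = 0 := by
    intro i hi
    rcases G.shiftedDeg_eq_zero_or_one_le hconn hcard hi with h | ⟨hl, h⟩
    · exact Or.inl h
    -- If d_n = 1, majorization forces the least eigenvalue to be at most d_n - 1 = 0, hence 0.
    · exact Or.inr ⟨h, le_antisymm (h ▸ hconn.nthLaplacianEigenvalue_last_le G hcard hl) (hx i hi)⟩
  constructor
  · intro hα
    rw [G.laplacianPowerSum_eq (by linarith), G.degreePowerBound_eq_sum_shiftedDeg hcard,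
      ← hconn.nthLaplacianEigenvalue_eq_shiftedDeg_iff G hcard]
    exact sum_rpow_le_sum_rpow_and_eq_iff hα hx
      (fun i hi => by rcases hy i hi with h | ⟨h, -⟩ <;> linarith) hanti hle heq
  · intro hα hα1
    rw [G.laplacianPowerSum_eq hα.ne', G.degreePowerBound_eq_sum_shiftedDeg hcard,
      ← hconn.nthLaplacianEigenvalue_eq_shiftedDeg_iff G hcard]
    exact sum_rpow_le_sum_rpow_and_eq_iff_of_lt_one hα hα1 hx hy hanti hle heq
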